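/- Let $\mathbb T$ be the unit circle with normalized Lebesgue measure $\ell$, let $I\subset\mathbb T$ be measurable and $J=\mathbb T\setminus I$, with $\ell(I)>0$, $\ell(J)>0$, and assume that the boundary $\partial I$ of $I$ in $\mathbb T$ satisfies $\ell(\partial I)=0$. Let $H^2$ be the subspace of $L^2(\mathbb T)$ of functions whose Fourier coefficients of strictly negative index vanish. Let $f\in L^2(I)$ and let $g_0$ be the solution of the bounded extremal problem $BEP_{2,\infty}$, that is, $g_0\in H^2$, $|g_0|\le 1$ a.e. on $J$, and $$\|f-g_0\|_{L^2(I)}=\min\{\|f-g\|_{L^2(I)}:\ g\in H^2,\ |g|\le 1\ \text{a.e. on } J\}.$$ Then $|g_0|=1$ a.e. on $J$, unless $f=g_{|I}$ for some $g\in H^2$ with $|g|\le 1$ a.e. on $J$ (that is, at least one of these two alternatives holds). -/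

import Mathlib

open MeasureTheory AddCircle

noncomputable section

/-- The unit circle `𝕋`, parametrized by the angle `θ ∈ ℝ / 2πℤ` of the point `e^{iθ}`. -/
abbrev Torus : Type := AddCircle (2 * Real.pi)

instance factTwoPiPos : Fact (0 < 2 * Real.pi) := ⟨Real.two_pi_pos⟩

/-- Normalized Lebesgue measure `ℓ` on the circle (total mass `1`). -/
abbrev ell : Measure Torus := haarAddCircle

/-- The Lebesgue space `L²(E)` of classes of complex functions on a subset `E` of the circle. -/
abbrev L2On (E : Set Torus) : Type := Lp ℂ 2 (ell.restrict E)

/-- The Hardy space `H²`: the functions in `L²(𝕋)` whose Fourier coefficients of strictly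
negative index vanish. -/
def hardyTwo : Submodule ℂ (Lp ℂ 2 ell) where
  carrier := {g | ∀ n : ℤ, n < 0 → fourierCoeff (g : Torus → ℂ) n = 0}
  zero_mem' := by
    intro n _
    rw [← fourierBasis_repr]
    simp
  add_mem' := by
    intro a b ha hb n hn
    have ha' := ha n hn
    have hb' := hb n hn
    rw [← fourierBasis_repr] at ha' hb' ⊢
    simp [ha', hb']
  smul_mem' := by
    intro c a ha n hn
    have ha' := ha n hn
    rw [← fourierBasis_repr] at ha' ⊢
    simp [ha']

/-- The restriction (trace) `g|_E ∈ L²(E)` of a function `g ∈ L²(𝕋)`. -/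
def traceOn (E : Set Torus) (g : Lp ℂ 2 ell) : L2On E :=
  LpToLpRestrictCLM Torus ℂ ℂ ell 2 E g

/-- The traces agree almost everywhere on `E` with the function itself. -/
theorem traceOn_ae_eq (E : Set Torus) (g : Lp ℂ 2 ell) :
    (traceOn E g : Torus → ℂ) =ᵐ[ell.restrict E] g :=
  LpToLpRestrictCLM_coeFn ℂ E g

/-- The competitors of the bounded extremal problem: the functions `g ∈ H²` such that
`|g| ≤ 1` almost everywhere on `J = 𝕋 \ I`. -/
def bepAdmissible (I : Set Torus) : Set (Lp ℂ 2 ell) :=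
  {g | g ∈ hardyTwo ∧ ∀ᵐ θ ∂(ell.restrict Iᶜ), ‖g θ‖ ≤ 1}

/-- `g₀` solves the bounded extremal problem `BEP_{2,∞}` for `f ∈ L²(I)`: it is admissible and
`‖f - g₀‖_{L²(I)}` is the minimum of `‖f - g‖_{L²(I)}` over all admissible `g`. -/
def IsBEPSolution (I : Set Torus) (f : L2On I) (g₀ : Lp ℂ 2 ell) : Prop :=
  g₀ ∈ bepAdmissible I ∧ ∀ g ∈ bepAdmissible I, ‖f - traceOn I g₀‖ ≤ ‖f - traceOn I g‖

end

noncomputable section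

open MeasureTheory AddCircle Filter Topology
open scoped ComplexConjugate

/-! Let R = f - g₀ on I, and suppose g₀ ≠ 0 and |g₀| ≤ 1 - ε on some E ⊆ J of positive measure. If w
is a bounded Hardy function, purely imaginary on J \ E, then g₀(1 + t(w - c)) is admissible for each
c > 0 and all small t > 0: on J \ E the imaginary direction raises the modulus only at second order
in t, which c pays for, and on E there is room. Optimality and c → 0 give Re ∫_I R̄ g₀ w ≤ 0
(`IsBEPSolution.re_integral_mul_le_zero`). With w = ±ib, b real on J \ E, the function F = 1_I R̄ g₀
satisfies Im ∫ F b = 0.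

Such b are numerous enough to force F = 0. The key is a duality (`ae_eq_zero_of_forall_realOff`): a
real integrable G that vanishes on E and annihilates Re a, for all bounded Hardy a real off E, is
zero. Applied to G = Im(F b), it gives Im(F b) = 0 a.e. for every b, hence F = 0
(`ae_eq_zero_of_forall_realOff_union`). A nonzero Hardy function vanishes only on a null set
(`IsHardy.ae_eq_zero`), so R = 0 and f is the trace of g₀. If g₀ = 0, all small bounded Hardy
directions are admissible, so 1_I R̄ is a Hardy function vanishing on J, hence zero.

For G in L² the duality compares Q = G + iG̃ with w = u + iũ, u the indicator of X ⊆ E: the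
relations ∫ Gw = 0 and ∫ Qw = 0 yield ∫_X Q = 0, so Q vanishes on E and thus everywhere. Only two
facts of Hardy space theory enter: means are multiplicative, and exp(tw) is a bounded Hardy function
when Re w is bounded (`exists_isHardy_exp`). -/

/-! ### Fourier coefficients and products of Hardy functions -/

/-- Square integrable functions whose Fourier coefficients of negative index vanish. -/
structure IsHardy (g : Torus → ℂ) : Prop where
  memLp : MemLp g 2 ell
  coeff : ∀ n : ℤ, n < 0 → fourierCoeff g n = 0

/-- Essentially bounded functions in the Hardy class. -/
structure IsBddHardy (b : Torus → ℂ) : Prop extends IsHardy b where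
  bdd : ∃ C : ℝ, ∀ᵐ θ ∂ell, ‖b θ‖ ≤ C

theorem fourierCoeff_zero_eq (f : Torus → ℂ) : fourierCoeff f 0 = ∫ θ, f θ ∂ell := by
  simp [fourierCoeff]

theorem norm_fourier_apply (n : ℤ) (θ : Torus) : ‖fourier n θ‖ = 1 := by
  rw [fourier_apply]; exact Circle.norm_coe _

theorem memLp_fourier_mul {p : ENNReal} (n : ℤ) {f : Torus → ℂ} (hf : MemLp f p ell) :
    MemLp (fun θ => fourier n θ * f θ) p ell :=
  hf.of_le_mul (c := 1)
    ((fourier n).continuous.aestronglyMeasurable.mul hf.aestronglyMeasurable)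
    (ae_of_all _ fun θ => by rw [norm_mul, norm_fourier_apply])

theorem fourierCoeff_fourier_mul (m n : ℤ) (f : Torus → ℂ) :
    fourierCoeff (fun θ => fourier m θ * f θ) n = fourierCoeff f (n - m) := by
  unfold fourierCoeff
  congr 1; ext θ
  rw [smul_eq_mul, smul_eq_mul, ← mul_assoc, ← fourier_add]
  congr 3; ring

theorem fourierCoeff_conj (f : Torus → ℂ) (n : ℤ) :
    fourierCoeff (fun θ => conj (f θ)) n = conj (fourierCoeff f (-n)) := by
  unfold fourierCoeff
  rw [← integral_conj]
  congr 1; ext θ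
  rw [smul_eq_mul, smul_eq_mul, map_mul, neg_neg, fourier_neg]

theorem fourierCoeff_conj_mul_eq_inner {f g : Torus → ℂ} (hf : MemLp f 2 ell)
    (hg : MemLp g 2 ell) :
    inner ℂ (hf.toLp f) (hg.toLp g) = ∫ θ, conj (f θ) * g θ ∂ell := by
  rw [L2.inner_def]
  apply integral_congr_ae
  filter_upwards [hf.coeFn_toLp, hg.coeFn_toLp] with θ h1 h2
  rw [h1, h2, RCLike.inner_apply, mul_comm]

theorem inner_fourierBasis_toLp {f : Torus → ℂ} (hf : MemLp f 2 ell) (n : ℤ) :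
    inner ℂ (fourierBasis n) (hf.toLp f) = fourierCoeff f n := by
  rw [← HilbertBasis.repr_apply_apply, fourierBasis_repr]
  exact congrFun (fourierCoeff_congr_ae hf.coeFn_toLp) n

/-- The Fourier coefficients of a product are given by convolution. -/
theorem hasSum_fourierCoeff_mul {f g : Torus → ℂ} (hf : MemLp f 2 ell) (hg : MemLp g 2 ell)
    (n : ℤ) : HasSum (fun k : ℤ => fourierCoeff f (n - k) * fourierCoeff g k)
      (fourierCoeff (fun θ => f θ * g θ) n) := by
  -- Parseval for zⁿ f̄ against g: the k-th coefficient of zⁿ f̄ is the conjugate of the (n - k)-th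
  -- coefficient of f.
  have hf' : MemLp (fun θ => fourier n θ * conj (f θ)) 2 ell := memLp_fourier_mul n hf.star
  have h := (fourierBasis (T := 2 * Real.pi)).hasSum_inner_mul_inner (hf'.toLp _) (hg.toLp _)
  rw [fourierCoeff_conj_mul_eq_inner hf' hg] at h
  have e : fourierCoeff (fun θ => f θ * g θ) n
      = ∫ θ, conj (fourier n θ * conj (f θ)) * g θ ∂ell := by
    refine integral_congr_ae (ae_of_all _ fun θ => ?_)
    simp only [fourier_neg, map_mul, Complex.conj_conj, smul_eq_mul, mul_assoc]
  rw [e]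
  have e2 k : fourierCoeff f (n - k) * fourierCoeff g k
      = inner ℂ (hf'.toLp _) (fourierBasis k) * inner ℂ (fourierBasis k) (hg.toLp _) := by
    rw [inner_fourierBasis_toLp, ← inner_conj_symm, inner_fourierBasis_toLp,
      fourierCoeff_fourier_mul, fourierCoeff_conj, Complex.conj_conj, neg_sub]
  simp only [e2]
  exact h

theorem ae_eq_zero_of_fourierCoeff_eq_zero {f : Torus → ℂ} (hf : MemLp f 2 ell)
    (h : ∀ n, fourierCoeff f n = 0) : f =ᵐ[ell] 0 := by
  have : hf.toLp f = 0 := by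
    apply (fourierBasis (T := 2 * Real.pi)).repr.injective
    ext n
    rw [HilbertBasis.repr_apply_apply, inner_fourierBasis_toLp, h]
    simp
  have h0 := hf.coeFn_toLp
  rw [this] at h0
  exact h0.symm.trans (Lp.coeFn_zero _ _ _)

theorem IsHardy.integrable {f : Torus → ℂ} (hf : IsHardy f) : Integrable f ell :=
  hf.memLp.integrable (by norm_num)

theorem IsHardy.add {f g : Torus → ℂ} (hf : IsHardy f) (hg : IsHardy g) :
    IsHardy (fun θ => f θ + g θ) :=
  ⟨hf.memLp.add hg.memLp, fun n hn => by
    have := congrFun (fourierCoeff.add hf.integrable hg.integrable) n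
    simp only [Pi.add_apply, hf.coeff n hn, hg.coeff n hn, add_zero] at this
    exact this⟩

theorem IsHardy.const_mul {f : Torus → ℂ} (hf : IsHardy f) (c : ℂ) :
    IsHardy (fun θ => c * f θ) :=
  ⟨hf.memLp.const_mul c, fun n hn => by
    rw [fourierCoeff.const_mul, hf.coeff n hn, mul_zero]⟩

theorem IsHardy.fourierCoeff_mul {f g : Torus → ℂ} (hf : IsHardy f) (hg : IsHardy g)
    (n : ℤ) (hn : n < 0) : fourierCoeff (fun θ => f θ * g θ) n = 0 := by
  refine (hasSum_fourierCoeff_mul hf.memLp hg.memLp n).unique ?_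
  convert hasSum_zero using 2 with k
  rcases lt_or_ge k 0 with hk | hk
  · rw [hg.coeff k hk, mul_zero]
  · rw [hf.coeff (n - k) (by linarith), zero_mul]

/-- The mean is multiplicative on the Hardy class. -/
theorem IsHardy.integral_mul {f g : Torus → ℂ} (hf : IsHardy f) (hg : IsHardy g) :
    ∫ θ, f θ * g θ ∂ell = (∫ θ, f θ ∂ell) * ∫ θ, g θ ∂ell := by
  rw [← fourierCoeff_zero_eq, ← fourierCoeff_zero_eq, ← fourierCoeff_zero_eq]
  refine (hasSum_fourierCoeff_mul hf.memLp hg.memLp 0).unique ?_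
  have := hasSum_single (f := fun k : ℤ => fourierCoeff f (0 - k) * fourierCoeff g k) 0 ?_
  · simpa using this
  · intro k hk
    rcases lt_or_gt_of_ne hk with hk | hk
    · rw [hg.coeff k hk, mul_zero]
    · rw [hf.coeff (0 - k) (by linarith), zero_mul]

theorem IsHardy.mul_bdd {f b : Torus → ℂ} (hf : IsHardy f) (hb : IsBddHardy b) :
    IsHardy (fun θ => f θ * b θ) := by
  obtain ⟨C, hC⟩ := hb.bdd
  refine ⟨hf.memLp.of_le_mul (c := C)
    (hf.memLp.aestronglyMeasurable.mul hb.memLp.aestronglyMeasurable) ?_,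
    hf.fourierCoeff_mul hb.toIsHardy⟩
  filter_upwards [hC] with θ h
  rw [norm_mul, mul_comm]
  gcongr

theorem IsBddHardy.of_bound {b : Torus → ℂ} (hm : AEStronglyMeasurable b ell) (C : ℝ)
    (hC : ∀ᵐ θ ∂ell, ‖b θ‖ ≤ C) (h : ∀ n : ℤ, n < 0 → fourierCoeff b n = 0) : IsBddHardy b :=
  ⟨⟨MemLp.of_bound hm C hC, h⟩, C, hC⟩

theorem IsBddHardy.mul {a b : Torus → ℂ} (ha : IsBddHardy a) (hb : IsBddHardy b) :
    IsBddHardy (fun θ => a θ * b θ) := by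
  refine ⟨ha.toIsHardy.mul_bdd hb, ?_⟩
  obtain ⟨A, hA⟩ := ha.bdd
  obtain ⟨B, hB⟩ := hb.bdd
  refine ⟨A * B, ?_⟩
  filter_upwards [hA, hB] with θ h1 h2
  rw [norm_mul]
  exact mul_le_mul h1 h2 (norm_nonneg _) ((norm_nonneg _).trans h1)

theorem IsBddHardy.add {a b : Torus → ℂ} (ha : IsBddHardy a) (hb : IsBddHardy b) :
    IsBddHardy (fun θ => a θ + b θ) := by
  refine ⟨ha.toIsHardy.add hb.toIsHardy, ?_⟩
  obtain ⟨A, hA⟩ := ha.bdd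
  obtain ⟨B, hB⟩ := hb.bdd
  refine ⟨A + B, ?_⟩
  filter_upwards [hA, hB] with θ h1 h2
  exact (norm_add_le _ _).trans (add_le_add h1 h2)

theorem isBddHardy_fourier {n : ℤ} (hn : 0 ≤ n) : IsBddHardy (fun θ => fourier n θ) := by
  refine .of_bound (fourier n).continuous.aestronglyMeasurable 1
    (ae_of_all _ fun θ => (norm_fourier_apply n θ).le) fun m hm => ?_
  have := fourierCoeff_fourier (T := 2 * Real.pi) n
  change fourierCoeff (⇑(fourier n)) m = 0
  rw [this]
  simp [show m ≠ n by omega]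

theorem isBddHardy_const (c : ℂ) : IsBddHardy (fun _ => c) := by
  have h := isBddHardy_fourier (le_refl 0)
  simp only [fourier_zero] at h
  refine ⟨by simpa using h.toIsHardy.const_mul c, ‖c‖, ae_of_all _ fun _ => le_rfl⟩

theorem IsBddHardy.const_mul {b : Torus → ℂ} (hb : IsBddHardy b) (c : ℂ) :
    IsBddHardy (fun θ => c * b θ) := (isBddHardy_const c).mul hb

theorem IsBddHardy.pow {b : Torus → ℂ} (hb : IsBddHardy b) (n : ℕ) :
    IsBddHardy (fun θ => b θ ^ n) ∧ ∫ θ, b θ ^ n ∂ell = (∫ θ, b θ ∂ell) ^ n := by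
  induction n with
  | zero => simpa using isBddHardy_const 1
  | succ n ih =>
    simp only [pow_succ]
    exact ⟨ih.1.mul hb, by rw [ih.1.toIsHardy.integral_mul hb.toIsHardy, ih.2]⟩

/-! ### Bounded limits and exponentials -/

/-- Limits of uniformly bounded almost everywhere convergent sequences of bounded Hardy functions. -/
theorem IsBddHardy.of_tendsto {b : ℕ → Torus → ℂ} {c : Torus → ℂ} (hb : ∀ k, IsBddHardy (b k))
    (C : ℝ) (hC : ∀ k, ∀ᵐ θ ∂ell, ‖b k θ‖ ≤ C)
    (h : ∀ᵐ θ ∂ell, Tendsto (fun k => b k θ) atTop (𝓝 (c θ))) :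
    IsBddHardy c ∧ Tendsto (fun k => ∫ θ, b k θ ∂ell) atTop (𝓝 (∫ θ, c θ ∂ell)) := by
  have hm k : AEStronglyMeasurable (b k) ell := (hb k).memLp.aestronglyMeasurable
  have hc : AEStronglyMeasurable c ell := aestronglyMeasurable_of_tendsto_ae atTop hm h
  refine ⟨.of_bound hc C ?_ fun n hn => ?_, ?_⟩
  · filter_upwards [ae_all_iff.2 hC, h] with θ h1 h2
    exact le_of_tendsto h2.norm (Eventually.of_forall h1)
  · have : Tendsto (fun k => fourierCoeff (b k) n) atTop (𝓝 (fourierCoeff c n)) := by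
      refine tendsto_integral_of_dominated_convergence (fun _ => C)
        (fun k => (fourier (-n)).continuous.aestronglyMeasurable.smul (hm k))
        (integrable_const C) (fun k => ?_) ?_
      · filter_upwards [hC k] with θ h1
        rw [norm_smul, norm_fourier_apply, one_mul]; exact h1
      · filter_upwards [h] with θ h1
        exact h1.const_smul _
    simp only [(hb _).coeff n hn] at this
    exact tendsto_nhds_unique this tendsto_const_nhds
  · exact tendsto_integral_of_dominated_convergence (fun _ => C) hm (integrable_const C) hC h

theorem norm_one_add_div_pow_le (z : ℂ) (k : ℕ) : ‖(1 + z / k) ^ k‖ ≤ Real.exp ‖z‖ := by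
  rcases Nat.eq_zero_or_pos k with rfl | hk
  · simp
  have hk' : (k : ℝ) ≠ 0 := by positivity
  calc ‖(1 + z / k) ^ k‖ ≤ (‖z‖ / k + 1) ^ k := by
        rw [norm_pow]
        gcongr
        refine (norm_add_le _ _).trans ?_
        simp [add_comm]
    _ ≤ Real.exp (‖z‖ / k) ^ k := by
        gcongr
        exact Real.add_one_le_exp _
    _ = Real.exp ‖z‖ := by
        rw [← Real.exp_nat_mul, mul_div_cancel₀ _ hk']

/-- The mean commutes with powers, so both claims pass to the limit in (1 + b/k)^k, dominated by
e^C. -/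
theorem IsBddHardy.exp {b : Torus → ℂ} (hb : IsBddHardy b) :
    IsBddHardy (fun θ => Complex.exp (b θ)) ∧
      ∫ θ, Complex.exp (b θ) ∂ell = Complex.exp (∫ θ, b θ ∂ell) := by
  obtain ⟨C, hC⟩ := hb.bdd
  have h1 k : IsBddHardy (fun θ => 1 + b θ / (k : ℕ)) := by
    have := (isBddHardy_const 1).add (hb.const_mul ((k : ℂ)⁻¹))
    simpa [div_eq_inv_mul] using this
  have h2 k : ∫ θ, (1 + b θ / (k : ℕ)) ∂ell = 1 + (∫ θ, b θ ∂ell) / k := by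
    rw [integral_add (integrable_const _) (hb.toIsHardy.integrable.div_const _),
      integral_div]
    simp
  have h := IsBddHardy.of_tendsto (fun k => ((h1 k).pow k).1) (Real.exp C) (fun k => by
      filter_upwards [hC] with θ hθ
      exact (norm_one_add_div_pow_le _ _).trans (Real.exp_le_exp.2 hθ))
    (ae_of_all _ fun θ => Complex.tendsto_one_add_div_pow_exp (b θ))
  refine ⟨h.1, tendsto_nhds_unique h.2 ?_⟩
  simp only [((h1 _).pow _).2, h2]
  exact Complex.tendsto_one_add_div_pow_exp _

/-! ### The conjugate function -/

/-- The orthogonal complement of the characters of negative index. -/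
def nonnegFreq : Submodule ℂ (Lp ℂ 2 ell) :=
  (Submodule.span ℂ {x | ∃ n : ℤ, n < 0 ∧ x = fourierBasis n})ᗮ

instance : nonnegFreq.HasOrthogonalProjection := by
  unfold nonnegFreq; infer_instance

/-- The operator `u ↦ u + i ũ`, where `ũ` is the conjugate function of `u`. -/
def herglotz : Lp ℂ 2 ell →L[ℂ] Lp ℂ 2 ell :=
  (2 : ℂ) • nonnegFreq.starProjection -
    (innerSL ℂ (fourierBasis (T := 2 * Real.pi) 0)).smulRight (fourierBasis 0)

theorem inner_fourierBasis_fourierBasis (m n : ℤ) :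
    inner ℂ (fourierBasis (T := 2 * Real.pi) m) (fourierBasis n) = if m = n then 1 else 0 :=
  orthonormal_iff_ite.1 fourierBasis.orthonormal m n

theorem ext_inner_fourierBasis {x y : Lp ℂ 2 ell}
    (h : ∀ n : ℤ, inner ℂ (fourierBasis n) x = inner ℂ (fourierBasis n) y) : x = y := by
  apply (fourierBasis (T := 2 * Real.pi)).repr.injective
  ext n
  rw [HilbertBasis.repr_apply_apply, HilbertBasis.repr_apply_apply, h]

theorem inner_fourierBasis_nonnegFreq (u : Lp ℂ 2 ell) (n : ℤ) :
    inner ℂ (fourierBasis n) (nonnegFreq.starProjection u) =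
      if n < 0 then 0 else inner ℂ (fourierBasis n) u := by
  split_ifs with hn
  · have h : nonnegFreq.starProjection u ∈ nonnegFreq := Submodule.starProjection_apply_mem _ _
    exact (Submodule.mem_orthogonal _ _).1 h _ (Submodule.subset_span ⟨n, hn, rfl⟩)
  · have h : fourierBasis (T := 2 * Real.pi) n ∈ nonnegFreq := by
      refine (Submodule.mem_orthogonal _ _).2 fun x hx => ?_
      induction hx using Submodule.span_induction with
      | mem x hx =>
        obtain ⟨m, hm, rfl⟩ := hx
        rw [inner_fourierBasis_fourierBasis, if_neg (by omega)]
      | zero => simp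
      | add x y _ _ h1 h2 => rw [inner_add_left, h1, h2, add_zero]
      | smul c x _ h1 => rw [inner_smul_left, h1, mul_zero]
    rw [← Submodule.inner_starProjection_left_eq_right,
      Submodule.starProjection_eq_self_iff.2 h]

theorem inner_fourierBasis_herglotz (u : Lp ℂ 2 ell) (n : ℤ) :
    inner ℂ (fourierBasis n) (herglotz u) =
      (if n < 0 then 0 else if n = 0 then 1 else 2) * inner ℂ (fourierBasis n) u := by
  simp only [herglotz, _root_.sub_apply, _root_.smul_apply,
    ContinuousLinearMap.smulRight_apply, inner_sub_right, inner_smul_right,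
    inner_fourierBasis_nonnegFreq, inner_fourierBasis_fourierBasis, innerSL_apply_apply]
  rcases lt_trichotomy n 0 with h | h | h
  · simp [h, h.ne]
  · subst h; simp; ring
  · simp [h.not_gt, h.ne']

theorem fourierCoeff_coeFn (x : Lp ℂ 2 ell) (n : ℤ) :
    fourierCoeff (x : Torus → ℂ) n = inner ℂ (fourierBasis n) x := by
  rw [← HilbertBasis.repr_apply_apply, fourierBasis_repr]

theorem isHardy_herglotz (u : Lp ℂ 2 ell) : IsHardy (herglotz u) :=
  ⟨Lp.memLp _, fun n hn => by
    rw [fourierCoeff_coeFn, inner_fourierBasis_herglotz, if_pos hn, zero_mul]⟩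

theorem integral_herglotz (u : Lp ℂ 2 ell) :
    ∫ θ, herglotz u θ ∂ell = ∫ θ, u θ ∂ell := by
  rw [← fourierCoeff_zero_eq, ← fourierCoeff_zero_eq, fourierCoeff_coeFn, fourierCoeff_coeFn,
    inner_fourierBasis_herglotz]
  simp

/-- The multiplier m(n) = 0, 1, 2 for n < 0, n = 0, n > 0 satisfies m(n) + m(-n) = 2, and for real u
the coefficients at n and -n are conjugate. Hence all coefficients of Tu + conj(Tu) - 2u vanish, T
being `herglotz`. -/
theorem re_herglotz {u : Lp ℂ 2 ell} (hu : ∀ᵐ θ ∂ell, (u θ).im = 0) :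
    ∀ᵐ θ ∂ell, (herglotz u θ).re = (u θ).re := by
  have hconj : ∀ n, fourierCoeff (u : Torus → ℂ) n = conj (fourierCoeff (u : Torus → ℂ) (-n)) := by
    intro n
    rw [← fourierCoeff_conj]
    refine congrFun (fourierCoeff_congr_ae ?_) n
    filter_upwards [hu] with θ h
    exact (Complex.conj_eq_iff_im.2 h).symm
  have hT n : fourierCoeff (herglotz u : Torus → ℂ) n =
      (if n < 0 then 0 else if n = 0 then 1 else 2) * fourierCoeff (u : Torus → ℂ) n := by
    rw [fourierCoeff_coeFn, inner_fourierBasis_herglotz, fourierCoeff_coeFn]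
  have hm := (Lp.memLp (herglotz u)).add (Lp.memLp (herglotz u)).star
  have hm2 := (Lp.memLp u).const_mul (-2)
  have key := ae_eq_zero_of_fourierCoeff_eq_zero (hm.add hm2) fun n => by
    have e1 := congrFun (fourierCoeff.add (hm.integrable (by norm_num))
      (hm2.integrable (by norm_num))) n
    have e2 := congrFun (fourierCoeff.add ((Lp.memLp (herglotz u)).integrable (by norm_num))
      ((Lp.memLp (herglotz u)).star.integrable (by norm_num))) n
    have e3 := fourierCoeff_conj (herglotz u) n
    rw [e1, Pi.add_apply, e2, Pi.add_apply, fourierCoeff.const_mul]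
    change _ + fourierCoeff (fun θ => conj (herglotz u θ)) n + _ = 0
    rw [e3, hT, hT]
    have := hconj n
    rcases lt_trichotomy n 0 with h | h | h
    · simp only [h, if_true, show ¬ (-n < 0) by omega, if_false, show -n ≠ 0 by omega, map_mul,
        ← this, map_ofNat]
      ring
    · subst h
      simp only [lt_irrefl, if_false, if_true, one_mul, neg_zero] at this ⊢
      rw [← this]; ring
    · simp only [h.not_gt, h.ne', if_false, show -n < 0 by omega, if_true]
      simp
  filter_upwards [key, hu] with θ h1 h2
  have := congrArg Complex.re h1
  simp at this
  linarith

theorem exists_isHardy_re_eq {u : Torus → ℝ} (hu : MemLp u 2 ell) :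
    ∃ w : Torus → ℂ, IsHardy w ∧ (∀ᵐ θ ∂ell, (w θ).re = u θ) ∧
      ∫ θ, w θ ∂ell = ((∫ θ, u θ ∂ell : ℝ) : ℂ) := by
  have hu' : MemLp (fun θ => (u θ : ℂ)) 2 ell := hu.ofReal
  refine ⟨herglotz (hu'.toLp _), isHardy_herglotz _, ?_, ?_⟩
  · have h := re_herglotz (u := hu'.toLp _) (by
      filter_upwards [hu'.coeFn_toLp] with θ h; simp [h])
    filter_upwards [h, hu'.coeFn_toLp] with θ h1 h2
    rw [h1, h2, Complex.ofReal_re]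
  · rw [integral_herglotz, integral_congr_ae hu'.coeFn_toLp, integral_complex_ofReal]

/-! ### Approximation by trigonometric polynomials -/

/-- Trigonometric polynomials. -/
def trigPoly : Submodule ℂ (Lp ℂ 2 ell) :=
  Submodule.span ℂ (Set.range (fourierBasis (T := 2 * Real.pi)))

theorem exists_bound_of_mem_trigPoly {p : Lp ℂ 2 ell} (hp : p ∈ trigPoly) :
    ∃ C : ℝ, ∀ᵐ θ ∂ell, ‖p θ‖ ≤ C := by
  unfold trigPoly at hp
  induction hp using Submodule.span_induction with
  | mem x hx =>
    obtain ⟨n, rfl⟩ := hx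
    refine ⟨1, ?_⟩
    rw [coe_fourierBasis]
    filter_upwards [coeFn_fourierLp 2 n] with θ h
    rw [h, norm_fourier_apply]
  | zero =>
    refine ⟨0, ?_⟩
    filter_upwards [Lp.coeFn_zero ℂ 2 ell] with θ h
    rw [h]
    simp
  | add x y _ _ h1 h2 =>
    obtain ⟨A, hA⟩ := h1
    obtain ⟨B, hB⟩ := h2
    refine ⟨A + B, ?_⟩
    filter_upwards [Lp.coeFn_add x y, hA, hB] with θ h a b
    rw [h]
    exact (norm_add_le _ _).trans (add_le_add a b)
  | smul c x _ h1 =>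
    obtain ⟨A, hA⟩ := h1
    refine ⟨‖c‖ * A, ?_⟩
    filter_upwards [Lp.coeFn_smul c x, hA] with θ h a
    rw [h, Pi.smul_apply, norm_smul]
    gcongr

theorem herglotz_mem_trigPoly {p : Lp ℂ 2 ell} (hp : p ∈ trigPoly) : herglotz p ∈ trigPoly := by
  unfold trigPoly at hp ⊢
  induction hp using Submodule.span_induction with
  | mem x hx =>
    obtain ⟨n, rfl⟩ := hx
    have : herglotz (fourierBasis n) =
        (if n < 0 then 0 else if n = 0 then 1 else 2 : ℂ) • fourierBasis n := by
      refine ext_inner_fourierBasis fun m => ?_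
      rw [inner_fourierBasis_herglotz, inner_smul_right, inner_fourierBasis_fourierBasis]
      by_cases h : m = n
      · rw [h]
      · simp [h]
    rw [this]
    exact Submodule.smul_mem _ _ (Submodule.subset_span ⟨n, rfl⟩)
  | zero => simp
  | add x y _ _ h1 h2 => rw [map_add]; exact Submodule.add_mem _ h1 h2
  | smul c x _ h1 => rw [map_smul]; exact Submodule.smul_mem _ _ h1

theorem isBddHardy_herglotz {p : Lp ℂ 2 ell} (hp : p ∈ trigPoly) : IsBddHardy (herglotz p) :=
  ⟨isHardy_herglotz p, exists_bound_of_mem_trigPoly (herglotz_mem_trigPoly hp)⟩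

theorem toLp_mem_trigPoly {q : C(Torus, ℂ)} (hq : q ∈ fourierSubalgebra (T := 2 * Real.pi)) :
    ContinuousMap.toLp 2 ell ℂ q ∈ trigPoly := by
  have hq' : q ∈ Submodule.span ℂ (Set.range (fourier (T := 2 * Real.pi))) := by
    rw [← fourierSubalgebra_coe]; exact hq
  have := Submodule.mem_map_of_mem
    (f := (ContinuousMap.toLp 2 ell ℂ : C(Torus, ℂ) →L[ℂ] Lp ℂ 2 ell).toLinearMap) hq'
  rw [Submodule.map_span, ← Set.range_comp] at this
  unfold trigPoly
  rw [coe_fourierBasis]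
  exact this

/-- Real continuous functions are uniform limits of real trigonometric polynomials. -/
theorem exists_real_trigPoly_near (v : C(Torus, ℝ)) {ε : ℝ} (hε : 0 < ε) :
    ∃ q ∈ fourierSubalgebra (T := 2 * Real.pi), (∀ θ, (q θ).im = 0) ∧
      ∀ θ, ‖q θ - (v θ : ℂ)‖ ≤ ε := by
  let v' : C(Torus, ℂ) := ⟨fun θ => (v θ : ℂ), by fun_prop⟩
  have hv : v' ∈ (fourierSubalgebra (T := 2 * Real.pi)).topologicalClosure := by
    rw [fourierSubalgebra_closure_eq_top]; trivial
  obtain ⟨q, hq, hd⟩ := Metric.mem_closure_iff.1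
    (show v' ∈ closure (fourierSubalgebra (T := 2 * Real.pi) : Set C(Torus, ℂ)) from hv) ε hε
  -- Averaging with the conjugate makes q real without enlarging the error.
  refine ⟨(2⁻¹ : ℂ) • (q + star q), ?_, fun θ => ?_, fun θ => ?_⟩
  · exact SMulMemClass.smul_mem _ (add_mem hq (star_mem hq))
  · simp
  · have h1 : ‖q θ - (v θ : ℂ)‖ ≤ ε := by
      have := (ContinuousMap.norm_coe_le_norm (q - v') θ)
      rw [← dist_eq_norm, dist_comm] at this
      exact this.trans hd.le
    have h2 : ((2⁻¹ : ℂ) • (q + star q)) θ - (v θ : ℂ) = (((q θ - (v θ : ℂ)).re : ℝ) : ℂ) := by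
      apply Complex.ext <;> simp
      ring
    rw [h2, Complex.norm_real]
    exact (Complex.abs_re_le_norm _).trans h1

theorem abs_clip_sub_le {M a b : ℝ} (ha : |a| ≤ M) : |a - max (-M) (min M b)| ≤ |a - b| := by
  have := abs_le.1 ha
  rcases le_total M b with h | h
  · rw [min_eq_left h, max_eq_right (by linarith), abs_sub_comm, abs_sub_comm a b,
      abs_of_nonneg (by linarith), abs_of_nonneg (by linarith)]
    linarith
  · rw [min_eq_right h]
    rcases le_total (-M) b with h' | h'
    · rw [max_eq_right h']
    · rw [max_eq_left h', abs_of_nonneg (by linarith), abs_of_nonneg (by linarith)]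
      linarith

/-- The uniform bound on the real part is what later controls exp(t · `herglotz p`). To get it, a
continuous L² approximation is clipped to [-M, M], which cannot increase its distance to u, and then
approximated uniformly. -/
theorem exists_trigPoly_near {u : Torus → ℂ} (hu : MemLp u 2 ell) {M : ℝ}
    (hM : ∀ᵐ θ ∂ell, |(u θ).re| ≤ M) (him : ∀ᵐ θ ∂ell, (u θ).im = 0) {ε : ℝ} (hε : 0 < ε)
    (hε1 : ε ≤ 1) : ∃ p ∈ trigPoly, (∀ᵐ θ ∂ell, (p θ).im = 0) ∧
      (∀ᵐ θ ∂ell, |(p θ).re| ≤ M + 1) ∧ dist p (hu.toLp u) ≤ ε + ε := by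
  have hur : MemLp (fun θ => (u θ).re) 2 ell := hu.re
  obtain ⟨v, hv, -⟩ := hur.exists_boundedContinuous_eLpNorm_sub_le (by norm_num)
    (ε := ENNReal.ofReal ε) (by simpa using hε)
  have hM0 : 0 ≤ M := by
    obtain ⟨θ, h⟩ := hM.exists
    exact (abs_nonneg _).trans h
  let v' : C(Torus, ℝ) := ⟨fun θ => max (-M) (min M (v θ)), by fun_prop⟩
  have hv' θ : |v' θ| ≤ M := abs_le.2 ⟨le_max_left _ _, max_le (by linarith) (min_le_left _ _)⟩
  obtain ⟨q, hq, hqi, hqd⟩ := exists_real_trigPoly_near v' hε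
  refine ⟨ContinuousMap.toLp 2 ell ℂ q, toLp_mem_trigPoly hq, ?_, ?_, ?_⟩
  · filter_upwards [ContinuousMap.coeFn_toLp (p := 2) (𝕜 := ℂ) ell q] with θ h
    rw [h, hqi]
  · filter_upwards [ContinuousMap.coeFn_toLp (p := 2) (𝕜 := ℂ) ell q] with θ h
    rw [h]
    have h1 := (Complex.abs_re_le_norm (q θ - v' θ)).trans (hqd θ)
    rw [Complex.sub_re, Complex.ofReal_re] at h1
    have h2 := hv' θ
    rw [abs_le] at *
    constructor <;> linarith [h1.1, h1.2, h2.1, h2.2]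
  · let V : Lp ℂ 2 ell := ContinuousMap.toLp 2 ell ℂ ⟨fun θ => (v' θ : ℂ), by fun_prop⟩
    have hV := ContinuousMap.coeFn_toLp (p := 2) (𝕜 := ℂ) ell ⟨fun θ => (v' θ : ℂ), by fun_prop⟩
    refine (dist_triangle _ V _).trans (add_le_add ?_ ?_)
    · rw [dist_eq_norm]
      have := Lp.norm_le_of_ae_bound (f := ContinuousMap.toLp 2 ell ℂ q - V) hε.le (by
        filter_upwards [Lp.coeFn_sub (ContinuousMap.toLp 2 ell ℂ q) V, hV,
          ContinuousMap.coeFn_toLp (p := 2) (𝕜 := ℂ) ell q] with θ h1 h2 h3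
        rw [h1, Pi.sub_apply, h2, h3]
        exact hqd θ)
      simpa [measureUnivNNReal] using this
    · rw [dist_comm, dist_eq_norm, Lp.norm_def]
      refine ENNReal.toReal_le_of_le_ofReal hε.le (le_trans (eLpNorm_mono_ae ?_) hv)
      filter_upwards [Lp.coeFn_sub (hu.toLp u) V, hV, hu.coeFn_toLp, hM, him] with θ h1 h2 h3 h4 h5
      rw [h1, Pi.sub_apply, h2, h3]
      have : u θ = ((u θ).re : ℂ) := Complex.ext (by simp) (by simp [h5])
      rw [this]
      change ‖((u θ).re : ℂ) - (v' θ : ℂ)‖ ≤ _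
      rw [← Complex.ofReal_sub, Complex.norm_real]
      exact abs_clip_sub_le h4

/-- A bounded real function is the real part of a Hardy function with bounded exponentials. -/
theorem exists_isHardy_exp {u : Torus → ℝ} (hm : AEStronglyMeasurable u ell) {M : ℝ}
    (hM : ∀ᵐ θ ∂ell, |u θ| ≤ M) :
    ∃ w : Torus → ℂ, IsHardy w ∧ (∀ᵐ θ ∂ell, (w θ).re = u θ) ∧
      ∀ t : ℝ, IsBddHardy (fun θ => Complex.exp (t * w θ)) ∧
        ∫ θ, Complex.exp (t * w θ) ∂ell = Complex.exp (t * (∫ θ, u θ ∂ell : ℝ)) := by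
  have hu : MemLp u 2 ell := MemLp.of_bound hm M hM
  have hu' : MemLp (fun θ => (u θ : ℂ)) 2 ell := hu.ofReal
  have hex (k : ℕ) := exists_trigPoly_near hu' (M := M) (by simpa using hM) (by simp)
    (ε := 1 / ((k : ℝ) + 1)) (by positivity) (by
      rw [div_le_one (by positivity)]; linarith [Nat.cast_nonneg (α := ℝ) k])
  choose p hp hpi hpM hpd using hex
  have hlim : Tendsto p atTop (𝓝 (hu'.toLp _)) := by
    rw [tendsto_iff_dist_tendsto_zero]
    refine squeeze_zero (fun _ => dist_nonneg) hpd ?_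
    simpa using tendsto_one_div_add_atTop_nhds_zero_nat.add
      (tendsto_one_div_add_atTop_nhds_zero_nat (𝕜 := ℝ))
  have hlimw := (herglotz.continuous.tendsto _).comp hlim
  obtain ⟨ns, hns, hae⟩ := (tendstoInMeasure_of_tendsto_Lp hlimw).exists_seq_tendsto_ae
  have hre := re_herglotz (u := hu'.toLp _) (by
    filter_upwards [hu'.coeFn_toLp] with θ h; simp [h])
  refine ⟨herglotz (hu'.toLp _), isHardy_herglotz _, ?_, fun t => ?_⟩
  · filter_upwards [hre, hu'.coeFn_toLp] with θ h1 h2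
    rw [h1, h2, Complex.ofReal_re]
  have hb k := ((isBddHardy_herglotz (hp (ns k))).const_mul t).exp
  -- The modulus of the exponential involves only the real part, so this bound is uniform in k even
  -- though the conjugate functions are not uniformly bounded.
  have := IsBddHardy.of_tendsto (fun k => (hb k).1) (Real.exp (|t| * (M + 1))) (fun k => by
      filter_upwards [re_herglotz (hpi (ns k)), hpM (ns k)] with θ h1 h2
      rw [Complex.norm_exp, Complex.re_ofReal_mul, h1]
      refine Real.exp_le_exp.2 ((le_abs_self _).trans ?_)
      rw [abs_mul]
      gcongr) (c := fun θ => Complex.exp (t * herglotz (hu'.toLp _) θ)) (by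
      filter_upwards [hae] with θ h
      exact (Complex.continuous_exp.tendsto _).comp (h.const_mul _))
  refine ⟨this.1, tendsto_nhds_unique this.2 ?_⟩
  simp only [(hb _).2]
  refine (Complex.continuous_exp.tendsto _).comp ?_
  simp only [integral_const_mul, integral_herglotz]
  refine Tendsto.const_mul _ ?_
  have e (x : Lp ℂ 2 ell) : ∫ θ, x θ ∂ell = inner ℂ (fourierBasis 0) x := by
    rw [← fourierCoeff_zero_eq, fourierCoeff_coeFn]
  have e2 : ((∫ θ, u θ ∂ell : ℝ) : ℂ) = inner ℂ (fourierBasis 0) (hu'.toLp _) := by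
    rw [← e, integral_congr_ae hu'.coeFn_toLp, integral_complex_ofReal]
  simp only [e]
  rw [e2]
  exact tendsto_const_nhds.inner (hlim.comp hns.tendsto_atTop)

/-! ### Uniqueness for Hardy functions -/

/-- Take Re w equal to the indicator of E. The factor exp(nw) has modulus one wherever h ≠ 0, so the
L¹ norm of h is unchanged, yet it multiplies the mean by exp(n ℓ(E)), which is unbounded in n. -/
theorem IsHardy.integral_eq_zero {h : Torus → ℂ} (hh : IsHardy h) {E : Set Torus}
    (hE : MeasurableSet E) (hE0 : 0 < ell E) (h0 : ∀ᵐ θ ∂ell, θ ∈ E → h θ = 0) :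
    ∫ θ, h θ ∂ell = 0 := by
  obtain ⟨w, -, hre, hexp⟩ := exists_isHardy_exp (u := E.indicator 1) (M := 1)
    (aestronglyMeasurable_const.indicator hE) (ae_of_all _ fun θ => by
      by_cases hθ : θ ∈ E <;> simp [hθ])
  have hc : 0 < ell.real E := ENNReal.toReal_pos hE0.ne' (measure_ne_top _ _)
  have hint : ∫ θ, E.indicator (1 : Torus → ℝ) θ ∂ell = ell.real E := integral_indicator_one hE
  rw [hint] at hexp
  have key (n : ℕ) : ‖∫ θ, h θ ∂ell‖ * (n * ell.real E) ≤ ∫ θ, ‖h θ‖ ∂ell := by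
    calc ‖∫ θ, h θ ∂ell‖ * (n * ell.real E)
        ≤ ‖∫ θ, h θ ∂ell‖ * Real.exp (n * ell.real E) := by
          gcongr
          linarith [Real.add_one_le_exp (n * ell.real E)]
      _ = ‖∫ θ, h θ * Complex.exp ((n : ℝ) * w θ) ∂ell‖ := by
          rw [hh.integral_mul (hexp n).1.toIsHardy, (hexp n).2, norm_mul, Complex.norm_exp]
          norm_cast
      _ ≤ ∫ θ, ‖h θ * Complex.exp ((n : ℝ) * w θ)‖ ∂ell := norm_integral_le_integral_norm _
      _ = ∫ θ, ‖h θ‖ ∂ell := by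
          apply integral_congr_ae
          filter_upwards [h0, hre] with θ h1 h2
          by_cases hθ : θ ∈ E
          · simp [h1 hθ]
          · rw [Set.indicator_of_notMem hθ] at h2
            rw [norm_mul, Complex.norm_exp, Complex.re_ofReal_mul, h2]
            simp
  by_contra hne
  have hpos : 0 < ‖∫ θ, h θ ∂ell‖ * ell.real E := mul_pos (norm_pos_iff.2 hne) hc
  obtain ⟨n, hn⟩ := exists_nat_gt ((∫ θ, ‖h θ‖ ∂ell) / (‖∫ θ, h θ ∂ell‖ * ell.real E))
  rw [div_lt_iff₀ hpos] at hn
  have := key n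
  linarith

/-- A Hardy function vanishing on a set of positive measure is zero. -/
theorem IsHardy.ae_eq_zero {h : Torus → ℂ} (hh : IsHardy h) {E : Set Torus}
    (hE : MeasurableSet E) (hE0 : 0 < ell E) (h0 : ∀ᵐ θ ∂ell, θ ∈ E → h θ = 0) :
    h =ᵐ[ell] 0 := by
  have key : ∀ n : ℕ, fourierCoeff h n = 0 := by
    intro n
    induction n using Nat.strong_induction_on with
    | _ n ih =>
      -- Once the coefficients below n vanish, z⁻ⁿ h is still Hardy, and its mean is the n-th
      -- coefficient of h.
      have hs : IsHardy (fun θ => fourier (-n : ℤ) θ * h θ) := by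
        refine ⟨memLp_fourier_mul _ hh.memLp, fun m hm => ?_⟩
        rw [fourierCoeff_fourier_mul, sub_neg_eq_add]
        rcases lt_or_ge (m + n) 0 with h1 | h1
        · exact hh.coeff _ h1
        · obtain ⟨k, hk⟩ := Int.eq_ofNat_of_zero_le h1
          rw [hk]
          exact ih k (by omega)
      have := hs.integral_eq_zero hE hE0 (by
        filter_upwards [h0] with θ h1 hθ
        rw [h1 hθ, mul_zero])
      rw [← fourierCoeff_zero_eq, fourierCoeff_fourier_mul] at this
      simpa using this
  refine ae_eq_zero_of_fourierCoeff_eq_zero hh.memLp fun n => ?_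
  rcases lt_or_ge n 0 with hn | hn
  · exact hh.coeff n hn
  · obtain ⟨k, rfl⟩ := Int.eq_ofNat_of_zero_le hn
    exact key k

/-! ### Bounded Hardy functions real off a set -/

/-- Bounded Hardy functions taking real values outside `X`. -/
structure RealOff (X : Set Torus) (b : Torus → ℂ) : Prop extends IsBddHardy b where
  im_eq : ∀ᵐ θ ∂ell, θ ∉ X → (b θ).im = 0

theorem RealOff.mono {X Y : Set Torus} {b : Torus → ℂ} (hb : RealOff X b) (h : X ⊆ Y) :
    RealOff Y b :=
  ⟨hb.toIsBddHardy, by filter_upwards [hb.im_eq] with θ h1 h2 using h1 fun h3 => h2 (h h3)⟩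

theorem realOff_const (X : Set Torus) (c : ℝ) : RealOff X (fun _ => (c : ℂ)) :=
  ⟨isBddHardy_const _, by simp⟩

theorem RealOff.add {X : Set Torus} {a b : Torus → ℂ} (ha : RealOff X a) (hb : RealOff X b) :
    RealOff X (fun θ => a θ + b θ) :=
  ⟨ha.toIsBddHardy.add hb.toIsBddHardy, by
    filter_upwards [ha.im_eq, hb.im_eq] with θ h1 h2 h
    simp [h1 h, h2 h]⟩

theorem RealOff.mul {X : Set Torus} {a b : Torus → ℂ} (ha : RealOff X a) (hb : RealOff X b) :
    RealOff X (fun θ => a θ * b θ) :=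
  ⟨ha.toIsBddHardy.mul hb.toIsBddHardy, by
    filter_upwards [ha.im_eq, hb.im_eq] with θ h1 h2 h
    simp [h1 h, h2 h]⟩

/-- Sine serves as a truncation inside the class: it keeps real values real and bounds them by 1. -/
theorem RealOff.sin {X : Set Torus} {b : Torus → ℂ} (hb : RealOff X b) :
    RealOff X (fun θ => Complex.sin (b θ)) := by
  refine ⟨?_, ?_⟩
  · have h1 := (hb.toIsBddHardy.const_mul (-Complex.I)).exp.1.const_mul (Complex.I / 2)
    have h2 := (hb.toIsBddHardy.const_mul Complex.I).exp.1.const_mul (-(Complex.I / 2))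
    have := h1.add h2
    convert this using 2 with θ
    rw [Complex.sin]
    ring_nf
  · filter_upwards [hb.im_eq] with θ h1 h
    have : b θ = ((b θ).re : ℂ) := Complex.ext (by simp) (by simp [h1 h])
    rw [this, Complex.sin_ofReal_im]

theorem tendsto_mul_sinh_div (z : ℂ) :
    Tendsto (fun k : ℕ => ((k : ℂ) + 1) * Complex.sinh (((1 / ((k : ℝ) + 1) : ℝ) : ℂ) * z))
      atTop (𝓝 z) := by
  have hd : HasDerivAt (fun t : ℂ => Complex.sinh (t * z)) z 0 := by
    have := ((hasDerivAt_id (0 : ℂ)).mul_const z).csinh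
    simpa using this
  have ht : Tendsto (fun k : ℕ => ((1 / ((k : ℝ) + 1) : ℝ) : ℂ)) atTop (𝓝[≠] 0) := by
    refine tendsto_nhdsWithin_iff.2 ⟨?_, Eventually.of_forall fun k => ?_⟩
    · have := (Complex.continuous_ofReal.tendsto 0).comp
        (tendsto_one_div_add_atTop_nhds_zero_nat (𝕜 := ℝ))
      simpa [Function.comp_def] using this
    · have : (k : ℝ) + 1 ≠ 0 := by positivity
      simpa using (by exact_mod_cast this : (k : ℂ) + 1 ≠ 0)
  have := (hasDerivAt_iff_tendsto_slope_zero.1 hd).comp ht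
  refine this.congr fun k => ?_
  simp

/-- Bounded approximations, real outside `X`, of `-i (u + i ũ)` with `u` the indicator of `X`. -/
theorem exists_realOff_tendsto {X : Set Torus} (hX : MeasurableSet X) :
    ∃ (w : Torus → ℂ) (b : ℕ → Torus → ℂ), IsHardy w ∧
      (∀ᵐ θ ∂ell, (w θ).re = X.indicator 1 θ) ∧ (∀ k, RealOff X (b k)) ∧
      (∀ k, ∀ᵐ θ ∂ell, θ ∉ X → ‖b k θ‖ ≤ ‖w θ‖) ∧
      ∀ θ, Tendsto (fun k => b k θ) atTop (𝓝 (-Complex.I * w θ)) := by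
  obtain ⟨w, hw, hre, hexp⟩ := exists_isHardy_exp (u := X.indicator 1) (M := 1)
    (aestronglyMeasurable_const.indicator hX) (ae_of_all _ fun θ => by
      by_cases hθ : θ ∈ X <;> simp [hθ])
  have hoff : ∀ᵐ θ ∂ell, θ ∉ X → ∀ k : ℕ, -Complex.I * (((k : ℂ) + 1) *
      Complex.sinh (((1 / ((k : ℝ) + 1) : ℝ) : ℂ) * w θ))
        = (((k + 1) * Real.sin (1 / ((k : ℝ) + 1) * (w θ).im) : ℝ) : ℂ) := by
    filter_upwards [hre] with θ h1 h k
    rw [Set.indicator_of_notMem h] at h1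
    have : w θ = ((w θ).im : ℂ) * Complex.I := Complex.ext (by simp [h1]) (by simp)
    have e : ((1 / ((k : ℝ) + 1) : ℝ) : ℂ) * w θ
        = ((1 / ((k : ℝ) + 1) * (w θ).im : ℝ) : ℂ) * Complex.I := by
      rw [Complex.ofReal_mul, mul_assoc, ← this]
    rw [e, Complex.sinh_mul_I, ← Complex.ofReal_sin, Complex.ofReal_mul, Complex.ofReal_add,
      Complex.ofReal_one, Complex.ofReal_natCast]
    linear_combination (-(k + 1 : ℂ) * (Real.sin (1 / ((k : ℝ) + 1) * (w θ).im) : ℂ)) *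
      Complex.I_sq
  -- Each term combines exp(±w/(k+1)), hence is bounded. Off X, w = iy and the term equals (k+1)
  -- sin(y/(k+1)), real and at most |y| in modulus.
  refine ⟨w, fun k θ => -Complex.I * (((k : ℂ) + 1) *
    Complex.sinh (((1 / ((k : ℝ) + 1) : ℝ) : ℂ) * w θ)), hw, hre, fun k => ⟨?_, ?_⟩,
    fun k => ?_, fun θ => (tendsto_mul_sinh_div (w θ)).const_mul _⟩
  · have h1 := (hexp (1 / ((k : ℝ) + 1))).1.const_mul (-Complex.I * ((k : ℂ) + 1) / 2)
    have h2 := (hexp (-(1 / ((k : ℝ) + 1)))).1.const_mul (Complex.I * ((k : ℂ) + 1) / 2)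
    convert h1.add h2 using 2 with θ
    rw [Complex.ofReal_neg, neg_mul (((1 / ((k : ℝ) + 1) : ℝ) : ℂ))]
    linear_combination (-Complex.I * ((k : ℂ) + 1) / 2) *
      Complex.two_sinh (((1 / ((k : ℝ) + 1) : ℝ) : ℂ) * w θ)
  · filter_upwards [hoff] with θ h1 h
    rw [h1 h k, Complex.ofReal_im]
  · filter_upwards [hoff] with θ h1 h
    rw [h1 h k, Complex.norm_real]
    refine le_trans ?_ (Complex.abs_im_le_norm _)
    have hk : (0 : ℝ) < k + 1 := by positivity
    rw [norm_mul, Real.norm_eq_abs, abs_of_pos hk, Real.norm_eq_abs]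
    calc ((k : ℝ) + 1) * |Real.sin (1 / ((k : ℝ) + 1) * (w θ).im)|
        ≤ (k + 1) * |1 / ((k : ℝ) + 1) * (w θ).im| :=
          mul_le_mul_of_nonneg_left Real.abs_sin_le_abs hk.le
      _ = |(w θ).im| := by
          rw [abs_mul, abs_of_pos (by positivity : 0 < 1 / ((k : ℝ) + 1))]
          field_simp

/-! ### Duality: annihilators of real parts -/

/-- The real parts of bounded Hardy functions real outside `E` have no nonzero square integrable
annihilator vanishing on `E`. -/
theorem ae_eq_zero_of_forall_realOff_of_memLp {E : Set Torus} (hE : MeasurableSet E)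
    (hE0 : 0 < ell E) {G : Torus → ℝ} (hG : MemLp G 2 ell) (h0 : ∀ᵐ θ ∂ell, θ ∈ E → G θ = 0)
    (hort : ∀ b, RealOff E b → ∫ θ, G θ * (b θ).re ∂ell = 0) : G =ᵐ[ell] 0 := by
  obtain ⟨Q, hQ, hQre, hQint⟩ := exists_isHardy_re_eq hG
  have hG1 : ∫ θ, G θ ∂ell = 0 := by
    simpa using hort _ (realOff_const E 1)
  rw [hG1, Complex.ofReal_zero] at hQint
  have hGc : MemLp (fun θ => (G θ : ℂ)) 2 ell := hG.ofReal
  have key : ∀ S : Set Torus, MeasurableSet S → ∫ θ in S ∩ E, Q θ ∂ell = 0 := by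
    intro S hS
    obtain ⟨w, b, hw, hre, hb, hbd, hlim⟩ := exists_realOff_tendsto (hS.inter hE)
    -- Here b k → -iw, whose real part is Im w. The domination is lacking on S ∩ E, where G
    -- vanishes.
    have him : ∫ θ, G θ * (w θ).im ∂ell = 0 := by
      have h1 : Tendsto (fun k => ∫ θ, G θ * (b k θ).re ∂ell) atTop
          (𝓝 (∫ θ, G θ * (-Complex.I * w θ).re ∂ell)) := by
        refine tendsto_integral_of_dominated_convergence (fun θ => ‖G θ‖ * ‖w θ‖)
          (fun k => hG.aestronglyMeasurable.mul
            (Complex.continuous_re.comp_aestronglyMeasurable (hb k).memLp.aestronglyMeasurable))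
          (hG.norm.integrable_mul hw.memLp.norm) (fun k => ?_) (ae_of_all _ fun θ =>
            ((Complex.continuous_re.tendsto _).comp (hlim θ)).const_mul _)
        filter_upwards [h0, hbd k] with θ h1 h2
        by_cases hθ : θ ∈ S ∩ E
        · simp [h1 hθ.2]
        · rw [norm_mul]
          gcongr
          exact (Complex.abs_re_le_norm _).trans (h2 hθ)
      simp only [fun k => hort _ ((hb k).mono Set.inter_subset_right)] at h1
      rw [tendsto_nhds_unique tendsto_const_nhds h1]
      simp
    have hGw : ∫ θ, (G θ : ℂ) * w θ ∂ell = 0 := by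
      have e : ∫ θ, (G θ : ℂ) * w θ ∂ell = ∫ θ, Complex.I * ((G θ * (w θ).im : ℝ) : ℂ) ∂ell := by
        apply integral_congr_ae
        filter_upwards [h0, hre] with θ h1 h2
        by_cases hθ : θ ∈ S ∩ E
        · simp [h1 hθ.2]
        · rw [Set.indicator_of_notMem hθ] at h2
          apply Complex.ext <;> simp [h2]
      rw [e, integral_const_mul, integral_complex_ofReal, him]
      simp
    have hQw : ∫ θ, Q θ * w θ ∂ell = 0 := by
      rw [hQ.integral_mul hw, hQint, zero_mul]
    -- Since Re Q = G, conj Q = 2G - Q.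
    have hcQw : ∫ θ, conj (Q θ) * w θ ∂ell = 0 := by
      have e : ∫ θ, conj (Q θ) * w θ ∂ell = ∫ θ, (2 * ((G θ : ℂ) * w θ) - Q θ * w θ) ∂ell := by
        apply integral_congr_ae
        filter_upwards [hQre] with θ h1
        have := Complex.add_conj (Q θ)
        rw [h1] at this
        push_cast at this
        linear_combination w θ * this
      have hi1 : Integrable (fun θ => (G θ : ℂ) * w θ) ell := hGc.integrable_mul hw.memLp
      have hi2 : Integrable (fun θ => Q θ * w θ) ell := hQ.memLp.integrable_mul hw.memLp
      rw [e, integral_sub (hi1.const_mul 2) hi2, integral_const_mul, hGw, hQw]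
      simp
    have hQcw : ∫ θ, Q θ * conj (w θ) ∂ell = 0 := by
      have : ∫ θ, conj (conj (Q θ) * w θ) ∂ell = 0 := by rw [integral_conj, hcQw, map_zero]
      simpa using this
    rw [← integral_indicator (hS.inter hE)]
    have e : ∫ θ, (S ∩ E).indicator Q θ ∂ell
        = ∫ θ, (1 / 2 : ℂ) * (Q θ * w θ + Q θ * conj (w θ)) ∂ell := by
      apply integral_congr_ae
      filter_upwards [hre] with θ h1
      have := Complex.add_conj (w θ)
      rw [← mul_add, this, h1]
      by_cases hθ : θ ∈ S ∩ E
      · simp only [Set.indicator_of_mem hθ, Pi.one_apply]; push_cast; ring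
      · simp only [Set.indicator_of_notMem hθ]; simp
    have hcw : MemLp (fun θ => conj (w θ)) 2 ell := hw.memLp.star
    have hi1 : Integrable (fun θ => Q θ * w θ) ell := hQ.memLp.integrable_mul hw.memLp
    have hi2 : Integrable (fun θ => Q θ * conj (w θ)) ell := hQ.memLp.integrable_mul hcw
    rw [e, integral_const_mul, integral_add hi1 hi2, hQw, hQcw]
    simp
  have hQE : Q =ᵐ[ell.restrict E] 0 := by
    refine ae_eq_zero_of_forall_setIntegral_eq_of_sigmaFinite
      (fun s _ _ => hQ.integrable.restrict.restrict) fun s hs _ => ?_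
    rw [Measure.restrict_restrict hs]
    exact key s hs
  have hQ0 := hQ.ae_eq_zero hE hE0 ((ae_restrict_iff' hE).1 hQE)
  filter_upwards [hQ0, hQre] with θ h1 h2
  rw [← h2, h1]
  simp

/-- Traces on the complement of `E` of bounded Hardy functions that are real there. -/
def realOffTraces (E : Set Torus) : Submodule ℝ (Lp ℝ 2 (ell.restrict Eᶜ)) where
  carrier := {x | ∃ b, RealOff E b ∧ x =ᵐ[ell.restrict Eᶜ] fun θ => (b θ).re}
  zero_mem' := ⟨_, realOff_const E 0, by
    filter_upwards [Lp.coeFn_zero ℝ 2 (ell.restrict Eᶜ)] with θ h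
    rw [h]
    simp⟩
  add_mem' := by
    rintro x y ⟨a, ha, hxa⟩ ⟨b, hb, hyb⟩
    refine ⟨_, ha.add hb, ?_⟩
    filter_upwards [hxa, hyb, Lp.coeFn_add x y] with θ h1 h2 h3
    rw [h3, Pi.add_apply, h1, h2, Complex.add_re]
  smul_mem' := by
    rintro c x ⟨a, ha, hxa⟩
    refine ⟨_, (realOff_const E c).mul ha, ?_⟩
    filter_upwards [hxa, Lp.coeFn_smul c x] with θ h1 h3
    rw [h3, Pi.smul_apply, h1, Complex.re_ofReal_mul, smul_eq_mul]

/-- A vector orthogonal to the traces, extended by zero to E, is an annihilator covered by the L²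
case. -/
theorem realOffTraces_topologicalClosure {E : Set Torus} (hE : MeasurableSet E)
    (hE0 : 0 < ell E) : (realOffTraces E).topologicalClosure = ⊤ := by
  rw [Submodule.topologicalClosure_eq_top_iff, Submodule.eq_bot_iff]
  intro x hx
  have hx' : MemLp (Eᶜ.indicator x) 2 ell := (memLp_indicator_iff_restrict hE.compl).2 (Lp.memLp x)
  have := ae_eq_zero_of_forall_realOff_of_memLp hE hE0 hx'
    (ae_of_all _ fun θ hθ => Set.indicator_of_notMem (by simpa using hθ) _) fun b hb => by
      have hbm : MemLp (fun θ => (b θ).re) 2 (ell.restrict Eᶜ) := hb.memLp.re.restrict _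
      have h1 := (Submodule.mem_orthogonal _ _).1 hx (hbm.toLp _) ⟨b, hb, hbm.coeFn_toLp⟩
      rw [L2.inner_def] at h1
      rw [← h1, ← integral_indicator hE.compl (f := fun θ => inner ℝ (hbm.toLp _ θ) (x θ))]
      apply integral_congr_ae
      have h2 := (ae_restrict_iff' hE.compl).1 hbm.coeFn_toLp
      filter_upwards [h2] with θ h3
      by_cases hθ : θ ∈ Eᶜ
      · rw [Set.indicator_of_mem hθ, Set.indicator_of_mem hθ, h3 hθ]
        simp
      · rw [Set.indicator_of_notMem hθ, Set.indicator_of_notMem hθ, zero_mul]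
  apply Lp.ext
  filter_upwards [Lp.coeFn_zero ℝ 2 (ell.restrict Eᶜ), ae_restrict_of_ae this,
    ae_restrict_mem hE.compl] with θ h1 h2 h3
  rw [h1]
  rwa [Set.indicator_of_mem h3] at h2

/-- By density some traces converge a.e. to G/|G| off E. Their sines are still traces and are
bounded by 1, so dominated convergence needs only G integrable and gives sin 1 · ∫ |G| = 0. -/
theorem ae_eq_zero_of_forall_realOff {E : Set Torus} (hE : MeasurableSet E)
    (hE0 : 0 < ell E) {G : Torus → ℝ} (hG : Integrable G ell) (h0 : ∀ᵐ θ ∂ell, θ ∈ E → G θ = 0)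
    (hort : ∀ b, RealOff E b → ∫ θ, G θ * (b θ).re ∂ell = 0) : G =ᵐ[ell] 0 := by
  have hGm : AEMeasurable G ell := hG.aestronglyMeasurable.aemeasurable
  have hc : MemLp (fun θ => G θ / |G θ|) 2 (ell.restrict Eᶜ) :=
    MemLp.of_bound (hGm.div hGm.abs).aestronglyMeasurable.restrict 1 (ae_of_all _ fun θ => by
      rw [norm_div, Real.norm_eq_abs, Real.norm_eq_abs, abs_abs]
      exact div_self_le_one _)
  have hmem : hc.toLp _ ∈ closure (realOffTraces E : Set (Lp ℝ 2 (ell.restrict Eᶜ))) := by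
    have : hc.toLp _ ∈ (realOffTraces E).topologicalClosure := by
      rw [realOffTraces_topologicalClosure hE hE0]; trivial
    exact this
  obtain ⟨x, hx, hxlim⟩ := mem_closure_iff_seq_limit.1 hmem
  obtain ⟨ns, -, hae⟩ := (tendstoInMeasure_of_tendsto_Lp hxlim).exists_seq_tendsto_ae
  choose b hb hxb using hx
  have hlim : ∀ᵐ θ ∂ell, θ ∈ Eᶜ →
      Tendsto (fun k => (b (ns k) θ).re) atTop (𝓝 (G θ / |G θ|)) := by
    rw [← ae_restrict_iff' hE.compl]
    filter_upwards [hae, ae_all_iff.2 fun k => hxb (ns k), hc.coeFn_toLp] with θ h1 h2 h3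
    rw [h3] at h1
    simpa only [h2] using h1
  have hzero k : ∫ θ, G θ * Real.sin (b (ns k) θ).re ∂ell = 0 := by
    rw [← hort _ (hb (ns k)).sin]
    apply integral_congr_ae
    filter_upwards [h0, (hb (ns k)).im_eq] with θ h1 h2
    by_cases hθ : θ ∈ E
    · simp [h1 hθ]
    · have : b (ns k) θ = ((b (ns k) θ).re : ℂ) := Complex.ext (by simp) (by simp [h2 hθ])
      rw [this, Complex.sin_ofReal_re, Complex.ofReal_re]
  have h1 : Tendsto (fun k => ∫ θ, G θ * Real.sin (b (ns k) θ).re ∂ell) atTop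
      (𝓝 (∫ θ, G θ * Real.sin (G θ / |G θ|) ∂ell)) := by
    refine tendsto_integral_of_dominated_convergence (fun θ => ‖G θ‖)
      (fun k => hG.aestronglyMeasurable.mul
        ((Real.continuous_sin.comp Complex.continuous_re).comp_aestronglyMeasurable
          (hb (ns k)).memLp.aestronglyMeasurable)) hG.norm (fun k => ae_of_all _ fun θ => ?_) ?_
    · rw [norm_mul, Real.norm_eq_abs (Real.sin _)]
      exact mul_le_of_le_one_right (norm_nonneg _) (Real.abs_sin_le_one _)
    · filter_upwards [h0, hlim] with θ h1 h2
      by_cases hθ : θ ∈ E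
      · simp [h1 hθ]
      · exact ((Real.continuous_sin.tendsto _).comp (h2 hθ)).const_mul _
  simp only [hzero] at h1
  have h2 := tendsto_nhds_unique h1 tendsto_const_nhds
  have h3 : ∀ θ, G θ * Real.sin (G θ / |G θ|) = |G θ| * Real.sin 1 := by
    intro θ
    rcases lt_trichotomy (G θ) 0 with h | h | h
    · rw [abs_of_neg h, div_neg, div_self h.ne, Real.sin_neg]; ring
    · simp [h]
    · rw [abs_of_pos h, div_self h.ne']
  simp only [h3] at h2
  have hs : 0 < Real.sin 1 := Real.sin_pos_of_pos_of_lt_pi one_pos (by linarith [Real.pi_gt_three])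
  rw [integral_mul_const, mul_eq_zero, or_iff_left hs.ne',
    integral_eq_zero_iff_of_nonneg (fun θ => abs_nonneg _) hG.abs] at h2
  filter_upwards [h2] with θ h
  exact abs_eq_zero.1 h

/-- Multiplying b by any a real off E stays in the class, and a is real on I, which carries F. So
Im(F b) annihilates every Re a, and the integral condition becomes pointwise. -/
theorem ae_eq_zero_of_forall_realOff_union {I E : Set Torus} (hI : MeasurableSet I)
    (hE : MeasurableSet E) (hIE : Disjoint I E) (hE0 : 0 < ell E) {F : Torus → ℂ}
    (hF : Integrable F ell) (h0 : ∀ᵐ θ ∂ell, θ ∉ I → F θ = 0)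
    (hort : ∀ b, RealOff (I ∪ E) b → (∫ θ, F θ * b θ ∂ell).im = 0) : F =ᵐ[ell] 0 := by
  have hmul {b : Torus → ℂ} (hb : IsBddHardy b) : Integrable (fun θ => F θ * b θ) ell := by
    obtain ⟨C, hC⟩ := hb.bdd
    exact hF.mul_bdd hb.memLp.aestronglyMeasurable hC
  have key : ∀ b, RealOff (I ∪ E) b → ∀ᵐ θ ∂ell, (F θ * b θ).im = 0 := by
    intro b hb
    refine ae_eq_zero_of_forall_realOff hE hE0 (hmul hb.toIsBddHardy).im ?_ fun a ha => ?_
    · filter_upwards [h0] with θ h1 hθ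
      have := h1 fun h => hIE.le_bot ⟨h, hθ⟩
      simp [this]
    · have hab := hb.mul (ha.mono Set.subset_union_right)
      rw [← hort _ hab]
      have := integral_im (hmul hab.toIsBddHardy)
      simp only [RCLike.im_to_complex] at this
      rw [← this]
      apply integral_congr_ae
      filter_upwards [h0, ha.im_eq] with θ h1 h2
      by_cases hθ : θ ∈ E
      · have := h1 fun h => hIE.le_bot ⟨h, hθ⟩
        simp [this]
      · rw [← mul_assoc, Complex.mul_im (F θ * b θ), h2 hθ]
        simp
  have h1 := key _ (realOff_const _ 1)
  -- F is real by the case b = 1. On I, Re w = 1, so the limit of Im(F b k) is Im(-iFw) = -F.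
  obtain ⟨w, b, -, hre, hb, -, hlim⟩ := exists_realOff_tendsto hI
  have h2 := ae_all_iff.2 fun k => key _ ((hb k).mono (Set.subset_union_left (t := E)))
  filter_upwards [h0, h1, h2, hre] with θ h0 h1 h2 h3
  by_cases hθ : θ ∈ I
  · have h4 : Tendsto (fun k => (F θ * b k θ).im) atTop (𝓝 (F θ * (-Complex.I * w θ)).im) :=
      (Complex.continuous_im.tendsto _).comp ((hlim θ).const_mul _)
    simp only [h2] at h4
    have h5 := tendsto_nhds_unique tendsto_const_nhds h4
    rw [Set.indicator_of_mem hθ] at h3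
    simp at h1 h3
    simp [h1, h3] at h5
    exact Complex.ext (by simp [h5]) (by simp [h1])
  · exact h0 hθ

/-! ### Variations of the extremal function -/

theorem isHardy_of_mem_hardyTwo {g : Lp ℂ 2 ell} (hg : g ∈ hardyTwo) : IsHardy g :=
  ⟨Lp.memLp g, hg⟩

theorem IsHardy.toLp_mem {h : Torus → ℂ} (hh : IsHardy h) : hh.memLp.toLp h ∈ hardyTwo :=
  fun n hn => by rw [fourierCoeff_congr_ae hh.memLp.coeFn_toLp, hh.coeff n hn]

theorem inner_traceOn_toLp {I : Set Torus} (R : L2On I) {h : Torus → ℂ} (hh : MemLp h 2 ell) :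
    inner ℂ R (traceOn I (hh.toLp h)) = ∫ θ in I, conj (R θ) * h θ ∂ell := by
  rw [L2.inner_def]
  apply integral_congr_ae
  filter_upwards [traceOn_ae_eq I (hh.toLp h), ae_restrict_of_ae hh.coeFn_toLp] with θ h1 h2
  rw [h1, h2, RCLike.inner_apply, mul_comm]

/-- First order optimality condition in an admissible direction. -/
theorem IsBEPSolution.re_integral_le_zero {I : Set Torus} {f : L2On I} {g₀ : Lp ℂ 2 ell}
    (hg₀ : IsBEPSolution I f g₀) {h : Torus → ℂ} (hh : IsHardy h) {t₀ : ℝ} (ht₀ : 0 < t₀)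
    (hadm : ∀ t : ℝ, 0 < t → t ≤ t₀ → ∀ᵐ θ ∂(ell.restrict Iᶜ), ‖g₀ θ + t * h θ‖ ≤ 1) :
    (∫ θ in I, conj ((f - traceOn I g₀) θ) * h θ ∂ell).re ≤ 0 := by
  rw [← inner_traceOn_toLp _ hh.memLp]
  set R := f - traceOn I g₀ with hR
  set H := traceOn I (hh.memLp.toLp h) with hH
  have key : ∀ t : ℝ, 0 < t → t ≤ t₀ → 2 * (inner ℂ R H).re ≤ t * ‖H‖ ^ 2 := by
    intro t ht ht'
    have h1 := hg₀.2 (g₀ + (t : ℂ) • hh.memLp.toLp h)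
      ⟨add_mem hg₀.1.1 (Submodule.smul_mem _ _ hh.toLp_mem), by
        filter_upwards [hadm t ht ht', ae_restrict_of_ae (Lp.coeFn_add g₀ _),
          ae_restrict_of_ae (Lp.coeFn_smul (t : ℂ) (hh.memLp.toLp h)),
          ae_restrict_of_ae hh.memLp.coeFn_toLp] with θ h1 h2 h3 h4
        rw [h2, Pi.add_apply, h3, Pi.smul_apply, h4]
        exact h1⟩
    have h2 : f - traceOn I (g₀ + (t : ℂ) • hh.memLp.toLp h) = R - (t : ℂ) • H := by
      simp only [traceOn, map_add, map_smul, hR, hH]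
      abel
    rw [h2, ← hR] at h1
    have h3 := pow_le_pow_left₀ (norm_nonneg _) h1 2
    rw [@norm_sub_sq ℂ _ _ _ _ R ((t : ℂ) • H), inner_smul_right, norm_smul, Complex.norm_real, Real.norm_eq_abs,
      mul_pow, sq_abs] at h3
    have h4 : RCLike.re ((t : ℂ) * inner ℂ R H) = t * (inner ℂ R H).re := by
      simp
    rw [h4] at h3
    have : t * (2 * (inner ℂ R H).re) ≤ t * (t * ‖H‖ ^ 2) := by linarith
    exact le_of_mul_le_mul_left this ht
  have hlim : Tendsto (fun t : ℝ => t * ‖H‖ ^ 2) (𝓝[>] 0) (𝓝 0) := by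
    have : Tendsto (fun t : ℝ => t * ‖H‖ ^ 2) (𝓝 0) (𝓝 (0 * ‖H‖ ^ 2)) :=
      (continuous_id.mul continuous_const).tendsto 0
    rw [zero_mul] at this
    exact this.mono_left nhdsWithin_le_nhds
  have := ge_of_tendsto hlim (by
    filter_upwards [Ioc_mem_nhdsGT ht₀] with t ht using key t ht.1 ht.2)
  linarith

/-- If the zero function solves the extremal problem, it interpolates the data. -/
theorem IsBEPSolution.eq_traceOn_of_ae_eq_zero {I : Set Torus} (hI : MeasurableSet I)
    (hJ : 0 < ell Iᶜ) {f : L2On I} {g₀ : Lp ℂ 2 ell} (hg₀ : IsBEPSolution I f g₀)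
    (h0 : g₀ =ᵐ[ell] 0) : f - traceOn I g₀ = 0 := by
  set R := f - traceOn I g₀ with hR
  have hle : ∀ b, IsBddHardy b → (∫ θ in I, conj (R θ) * b θ ∂ell).re ≤ 0 := by
    intro b hb
    obtain ⟨C, hC⟩ := hb.bdd
    have hC1 : 0 < |C| + 1 := by positivity
    refine hg₀.re_integral_le_zero hb.toIsHardy (inv_pos.2 hC1) fun t ht ht' => ?_
    filter_upwards [ae_restrict_of_ae h0, ae_restrict_of_ae hC] with θ h1 h2
    rw [h1, Pi.zero_apply, zero_add, norm_mul, Complex.norm_real, Real.norm_eq_abs, abs_of_pos ht]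
    calc t * ‖b θ‖ ≤ (|C| + 1)⁻¹ * (|C| + 1) := by
          gcongr
          linarith [le_abs_self C]
      _ = 1 := inv_mul_cancel₀ hC1.ne'
  have hzero : ∀ b, IsBddHardy b → ∫ θ in I, conj (R θ) * b θ ∂ell = 0 := by
    intro b hb
    have hc (c : ℂ) : (c * ∫ θ in I, conj (R θ) * b θ ∂ell).re ≤ 0 := by
      rw [← integral_const_mul]
      have := hle _ (hb.const_mul c)
      simpa only [mul_left_comm] using this
    have h1 := hc 1
    have h2 := hc (-1)
    have h3 := hc Complex.I
    have h4 := hc (-Complex.I)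
    simp at h1 h2 h3 h4
    exact Complex.ext (le_antisymm h1 h2) (le_antisymm h4 h3)
  have hRm : MemLp (I.indicator R) 2 ell := (memLp_indicator_iff_restrict hI).2 (Lp.memLp R)
  -- Testing against z⁻ⁿ with n < 0 gives the n-th Fourier coefficient of this function.
  have hP : IsHardy (fun θ => conj (I.indicator R θ)) := by
    refine ⟨hRm.star, fun n hn => ?_⟩
    have := hzero _ (isBddHardy_fourier (n := -n) (by omega))
    rw [← integral_indicator hI] at this
    rw [← this]
    refine integral_congr_ae (ae_of_all _ fun θ => ?_)
    by_cases hθ : θ ∈ I <;> simp [hθ, -fourier_apply, mul_comm]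
  have hP0 := hP.ae_eq_zero hI.compl hJ (ae_of_all _ fun θ hθ => by
    rw [Set.indicator_of_notMem hθ, map_zero])
  apply Lp.ext
  filter_upwards [Lp.coeFn_zero ℂ 2 (ell.restrict I), ae_restrict_of_ae hP0,
    ae_restrict_mem hI] with θ h1 h2 h3
  rw [Set.indicator_of_mem h3] at h2
  rw [h1]
  simpa using h2

/-- For z = iy the squared modulus is 1 - 2tc + t²(c² + y²). -/
theorem norm_one_add_mul_sub_le_one {z : ℂ} {C c t : ℝ} (hz : z.re = 0) (hC : ‖z‖ ≤ C)
    (ht : 0 < t) (htc : t * (C ^ 2 + c ^ 2) ≤ 2 * c) : ‖1 + t * (z - c)‖ ≤ 1 := by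
  have h1 : z.im ^ 2 ≤ C ^ 2 :=
    sq_le_sq.2 ((Complex.abs_im_le_norm z).trans (hC.trans (le_abs_self C)))
  rw [← sq_le_one_iff₀ (norm_nonneg _), ← Complex.normSq_eq_norm_sq, Complex.normSq_apply]
  simp [hz]
  nlinarith [mul_le_mul_of_nonneg_left h1 (sq_nonneg t), mul_le_mul_of_nonneg_left htc ht.le]

/-- Multiplicative variations of a solution of the extremal problem. -/
theorem IsBEPSolution.re_integral_mul_le_zero {I E : Set Torus} {f : L2On I} {g₀ : Lp ℂ 2 ell}
    (hg₀ : IsBEPSolution I f g₀) {ε : ℝ} (hε : 0 < ε) (hE : ∀ θ ∈ E, ‖g₀ θ‖ ≤ 1 - ε)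
    {w : Torus → ℂ} (hw : IsBddHardy w) (hre : ∀ᵐ θ ∂(ell.restrict Iᶜ), θ ∉ E → (w θ).re = 0) :
    (∫ θ in I, conj ((f - traceOn I g₀) θ) * g₀ θ * w θ ∂ell).re ≤ 0 := by
  obtain ⟨C, hC⟩ := hw.bdd
  have hC0 : 0 ≤ C := by
    obtain ⟨θ, h⟩ := hC.exists
    exact (norm_nonneg _).trans h
  have hg : IsHardy g₀ := isHardy_of_mem_hardyTwo hg₀.1.1
  set R := f - traceOn I g₀ with hR
  have hRm : MemLp (fun θ => conj (R θ)) 2 (ell.restrict I) := (Lp.memLp R).star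
  have hi1 : Integrable (fun θ => conj (R θ) * g₀ θ * w θ) (ell.restrict I) := by
    simp only [mul_assoc]
    exact hRm.integrable_mul ((hg.mul_bdd hw).memLp.restrict I)
  have hi2 : Integrable (fun θ => conj (R θ) * g₀ θ) (ell.restrict I) :=
    hRm.integrable_mul (hg.memLp.restrict I)
  have key : ∀ c : ℝ, 0 < c → (∫ θ in I, conj (R θ) * g₀ θ * w θ ∂ell).re ≤
      c * (∫ θ in I, conj (R θ) * g₀ θ ∂ell).re := by
    intro c hc
    have hwc : IsBddHardy (fun θ => w θ - c) := by
      simpa [sub_eq_add_neg] using hw.add (isBddHardy_const (-c))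
    -- The first bound in t₀ gives modulus at most (1 - ε)(1 + ε) on E; the second keeps the factor
    -- 1 + t(w - c) in the unit disc on J \ E.
    have h1 := hg₀.re_integral_le_zero (hg.mul_bdd hwc)
      (t₀ := min (ε / (C + c)) (2 * c / (C ^ 2 + c ^ 2))) (by positivity) fun t ht ht' => by
        have ht1 : t * (C + c) ≤ ε := (le_div_iff₀ (by positivity)).1 (ht'.trans (min_le_left _ _))
        have ht2 : t * (C ^ 2 + c ^ 2) ≤ 2 * c :=
          (le_div_iff₀ (by positivity)).1 (ht'.trans (min_le_right _ _))
        filter_upwards [hre, hg₀.1.2, ae_restrict_of_ae hC] with θ h1 h2 h3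
        have e : g₀ θ + t * (g₀ θ * (w θ - c)) = g₀ θ * (1 + t * (w θ - c)) := by ring
        rw [e, norm_mul]
        by_cases hθ : θ ∈ E
        · have h4 : ‖1 + (t : ℂ) * (w θ - c)‖ ≤ 1 + ε := by
            refine (norm_add_le _ _).trans ?_
            rw [norm_one, norm_mul, Complex.norm_real, Real.norm_eq_abs, abs_of_pos ht]
            have : ‖w θ - c‖ ≤ C + c := by
              refine (norm_sub_le _ _).trans ?_
              rw [Complex.norm_real, Real.norm_eq_abs, abs_of_pos hc]
              gcongr
            linarith [mul_le_mul_of_nonneg_left this ht.le]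
          have h5 := hE θ hθ
          have := mul_le_mul h5 h4 (norm_nonneg _) ((norm_nonneg _).trans h5)
          nlinarith [sq_nonneg ε]
        · exact mul_le_one₀ h2 (norm_nonneg _) (norm_one_add_mul_sub_le_one (h1 hθ) h3 ht ht2)
    have e : ∫ θ in I, conj (R θ) * (g₀ θ * (w θ - c)) ∂ell =
        ∫ θ in I, conj (R θ) * g₀ θ * w θ ∂ell - c * ∫ θ in I, conj (R θ) * g₀ θ ∂ell := by
      rw [← integral_const_mul, ← integral_sub hi1 (hi2.const_mul _)]
      refine integral_congr_ae (ae_of_all _ fun θ => ?_)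
      simp only
      ring
    rw [e, Complex.sub_re, Complex.re_ofReal_mul] at h1
    linarith
  have hlim : Tendsto (fun c : ℝ => c * (∫ θ in I, conj (R θ) * g₀ θ ∂ell).re) (𝓝[>] 0) (𝓝 0) := by
    have : Tendsto (fun c : ℝ => c * (∫ θ in I, conj (R θ) * g₀ θ ∂ell).re) (𝓝 0)
        (𝓝 (0 * (∫ θ in I, conj (R θ) * g₀ θ ∂ell).re)) :=
      (continuous_id.mul continuous_const).tendsto 0
    rw [zero_mul] at this
    exact this.mono_left nhdsWithin_le_nhds
  exact ge_of_tendsto hlim (by filter_upwards [self_mem_nhdsWithin] with c hc using key c hc)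

theorem IsBEPSolution.norm_eq_one_or_eq_traceOn {I : Set Torus} (hI : MeasurableSet I)
    (hJ : 0 < ell Iᶜ) {f : L2On I} {g₀ : Lp ℂ 2 ell} (hg₀ : IsBEPSolution I f g₀) :
    (∀ᵐ θ ∂(ell.restrict Iᶜ), ‖g₀ θ‖ = 1) ∨ f - traceOn I g₀ = 0 := by
  by_cases hz : g₀ =ᵐ[ell] 0
  · exact Or.inr (hg₀.eq_traceOn_of_ae_eq_zero hI hJ hz)
  have hg : IsHardy g₀ := isHardy_of_mem_hardyTwo hg₀.1.1
  have hgm : Measurable g₀ := (Lp.stronglyMeasurable g₀).measurable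
  have hne : ∀ᵐ θ ∂ell, g₀ θ ≠ 0 := by
    by_contra hcon
    have hm : MeasurableSet {θ | g₀ θ = 0} := hgm (measurableSet_singleton 0)
    refine hz (hg.ae_eq_zero hm (pos_iff_ne_zero.2 fun h => hcon ?_) (ae_of_all _ fun θ h => h))
    rw [ae_iff]
    simpa using h
  -- These sets exhaust the part of J where |g₀| < 1, so either all are null and the constraint is
  -- saturated, or one of them has positive measure.
  let E (n : ℕ) : Set Torus := Iᶜ ∩ {θ | ‖g₀ θ‖ ≤ 1 - 1 / ((n : ℝ) + 1)}
  have hEm n : MeasurableSet (E n) := hI.compl.inter (measurableSet_le hgm.norm measurable_const)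
  by_cases hEn : ∀ n, ell (E n) = 0
  · left
    have h1 : ∀ᵐ θ ∂ell, ∀ n, θ ∉ E n := ae_all_iff.2 fun n => measure_eq_zero_iff_ae_notMem.1 (hEn n)
    filter_upwards [hg₀.1.2, ae_restrict_of_ae h1, ae_restrict_mem hI.compl] with θ h2 h3 h4
    by_contra h5
    obtain ⟨n, hn⟩ := exists_nat_one_div_lt (sub_pos.2 (lt_of_le_of_ne h2 h5))
    exact h3 n ⟨h4, by change ‖g₀ θ‖ ≤ _; linarith⟩
  right
  push Not at hEn
  obtain ⟨n, hn⟩ := hEn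
  set R := f - traceOn I g₀ with hR
  have hi : Integrable (fun θ => conj (R θ) * g₀ θ) (ell.restrict I) :=
    MemLp.integrable_mul (p := 2) (q := 2) (Lp.memLp R).star (hg.memLp.restrict I)
  have hle : ∀ w, IsBddHardy w → (∀ᵐ θ ∂ell, θ ∉ I ∪ E n → (w θ).re = 0) →
      (∫ θ, I.indicator (fun θ => conj (R θ) * g₀ θ) θ * w θ ∂ell).re ≤ 0 := by
    intro w hw hre
    have := hg₀.re_integral_mul_le_zero (ε := 1 / ((n : ℝ) + 1)) (by positivity)
      (E := E n) (fun θ hθ => hθ.2) hw (by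
        filter_upwards [ae_restrict_of_ae hre, ae_restrict_mem hI.compl] with θ h1 h2 h3
        exact h1 (by simpa using ⟨h2, h3⟩))
    rw [← integral_indicator hI] at this
    refine le_of_eq_of_le ?_ this
    congr 2
    ext θ
    by_cases hθ : θ ∈ I <;> simp [hθ, hR]
  have hF := ae_eq_zero_of_forall_realOff_union hI (hEm n)
    (Set.disjoint_left.2 fun θ h1 h2 => h2.1 h1) (pos_iff_ne_zero.2 hn)
    ((integrable_indicator_iff hI).2 hi) (ae_of_all _ fun θ hθ => Set.indicator_of_notMem hθ _)
    fun b hb => by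
      -- The directions ib and -ib give opposite inequalities for Im ∫ F b.
      have hc (c : ℂ) (hc : c.re = 0) := hle _ (hb.toIsBddHardy.const_mul c) (by
        filter_upwards [hb.im_eq] with θ h1 h2
        rw [Complex.mul_re, hc, h1 h2]; simp)
      simp only [mul_left_comm _ (_ : ℂ) (b _), integral_const_mul] at hc
      have h1 := hc Complex.I (by simp)
      have h2 := hc (-Complex.I) (by simp)
      simp only [Complex.mul_re, Complex.neg_re, Complex.neg_im, Complex.I_re, Complex.I_im] at h1 h2
      linarith
  apply Lp.ext
  filter_upwards [Lp.coeFn_zero ℂ 2 (ell.restrict I), ae_restrict_of_ae hF,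
    ae_restrict_of_ae hne, ae_restrict_mem hI] with θ h1 h2 h3 h4
  rw [Set.indicator_of_mem h4] at h2
  rw [h1]
  simpa [h3] using h2

/-! ### Reduction to a measurable set -/

theorem norm_sub_traceOn {I : Set Torus} (f : L2On I) (g : Lp ℂ 2 ell) :
    ‖f - traceOn I g‖ = (eLpNorm (fun θ => f θ - g θ) 2 (ell.restrict I)).toReal := by
  rw [Lp.norm_def]
  congr 1
  apply eLpNorm_congr_ae
  filter_upwards [Lp.coeFn_sub f (traceOn I g), traceOn_ae_eq I g] with θ h1 h2
  rw [h1, Pi.sub_apply, h2]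

end

theorem mainTheorem2 (I : Set Torus) (hI : 0 < ell I) (hJ : 0 < ell Iᶜ)
    (hbdry : ell (frontier I) = 0) (f : L2On I) (g₀ : Lp ℂ 2 ell)
    (hg₀ : IsBEPSolution I f g₀) :
    (∀ᵐ θ ∂(ell.restrict Iᶜ), ‖g₀ θ‖ = 1) ∨
      ∃ g ∈ hardyTwo, (∀ᵐ θ ∂(ell.restrict Iᶜ), ‖g θ‖ ≤ 1) ∧ f = traceOn I g := by
  -- A null boundary makes I null measurable. Replacing it by an a.e. equal measurable set leaves
  -- the restricted measures unchanged, but `L2On I` and `L2On I'` are distinct types, so f has to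
  -- be transported.
  obtain ⟨I', hI', hII'⟩ := nullMeasurableSet_of_null_frontier hbdry
  have hr : ell.restrict I = ell.restrict I' := Measure.restrict_congr_set hII'
  have hrc : ell.restrict Iᶜ = ell.restrict I'ᶜ := Measure.restrict_congr_set hII'.compl
  have hfm : MemLp f 2 (ell.restrict I') := hr ▸ Lp.memLp f
  have hnorm (g : Lp ℂ 2 ell) : ‖hfm.toLp f - traceOn I' g‖ = ‖f - traceOn I g‖ := by
    have e (F : Torus → ℂ) : eLpNorm F 2 (ell.restrict I) = eLpNorm F 2 (ell.restrict I') := by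
      rw [hr]
    rw [norm_sub_traceOn, norm_sub_traceOn, e]
    congr 1
    apply eLpNorm_congr_ae
    filter_upwards [hfm.coeFn_toLp] with θ h
    rw [h]
  have hsol : IsBEPSolution I' (hfm.toLp f) g₀ := by
    refine ⟨⟨hg₀.1.1, hrc ▸ hg₀.1.2⟩, fun g hg => ?_⟩
    rw [hnorm, hnorm]
    exact hg₀.2 g ⟨hg.1, hrc ▸ hg.2⟩
  have hJ' : 0 < ell I'ᶜ := by rwa [← measure_congr hII'.compl]
  rw [hrc]
  refine (hsol.norm_eq_one_or_eq_traceOn hI' hJ').imp_right fun h => ?_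
  refine ⟨g₀, hg₀.1.1, hrc ▸ hg₀.1.2, ?_⟩
  rw [← sub_eq_zero, ← norm_eq_zero, ← hnorm, h, norm_zero]
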